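/- Let $X$ be a complex Banach space and $\mathcal B(X)$ the algebra of bounded linear operators on $X$; write $\mathcal N(T)$ and $\mathcal R(T)$ for the null space and the range of $T\in\mathcal B(X)$. Let $$\operatorname{dis}(T)=\inf\{n\in\mathbb N:\ \mathcal N(T)\cap\mathcal R(T^n)=\mathcal N(T)\cap\mathcal R(T^m)\text{ for all }m\ge n\},$$ where $\mathbb N=\{0,1,2,\dots\}$ and $\inf\emptyset=\infty$. The operator $T$ is called - left B-Fredholm if $d=\operatorname{dis}(T)$ is finite, $\mathcal N(T)\cap\mathcal R(T^d)$ is finite dimensional and $\mathcal R(T)+\mathcal N(T^d)$ is topologically complemented in $X$; - right B-Fredholm if $d=\operatorname{dis}(T)$ is finite, $\mathcal R(T)+\mathcal N(T^d)$ is closed of finite codimension and $\mathcal N(T)\cap\mathcal R(T^d)$ is topologically complemented in $X$; - B-Fredholm if there is an integer $n\ge 0$ such that $\mathcal R(T^n)$ is closed and the restriction $T|_{\mathcal R(T^n)}:\mathcal R(T^n)\to\mathcal R(T^n)$ is a Fredholm operator. Let $\sigma_{LBF}(T)$, $\sigma_{RBF}(T)$ and $\sigma_{BF}(T)$ be the sets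 of all $\lambda\in\mathbb C$ such that $\lambda-T$ is not left B-Fredholm, not right B-Fredholm and not B-Fredholm, respectively. Then for all $T,S\in\mathcal B(X)$ $$\sigma_*(TS)\setminus\{0\}=\sigma_*(ST)\setminus\{0\}\qquad\text{for each } *\in\{LBF,RBF,BF\}.$$ -/

import Mathlib

namespace BFredholm

variable {X : Type*} [NormedAddCommGroup X] [NormedSpace ℂ X]

/-- The set `Δ(T)` of all `n` such that `N(T) ∩ R(Tⁿ) = N(T) ∩ R(Tᵐ)` for all `m ≥ n`. -/
def stableSet (T : X →L[ℂ] X) : Set ℕ :=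
  {n | ∀ m, n ≤ m → T.ker ⊓ (T ^ n).range = T.ker ⊓ (T ^ m).range}

/-- The degree of stable iteration `dis(T) = inf Δ(T)`, equal to `⊤` if `Δ(T)` is empty. -/
noncomputable def dis (T : X →L[ℂ] X) : ℕ∞ :=
  sInf ((fun n : ℕ => (n : ℕ∞)) '' stableSet T)

/-- `T` is left B-Fredholm: `d = dis(T)` is finite, `N(T) ∩ R(T^d)` is finite dimensional and
`R(T) + N(T^d)` is topologically complemented. -/
def IsLeftBFredholm (T : X →L[ℂ] X) : Prop :=
  ∃ d : ℕ, dis T = d ∧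
    FiniteDimensional ℂ ↥(T.ker ⊓ (T ^ d).range) ∧
    (T.range ⊔ (T ^ d).ker).ClosedComplemented

/-- `T` is right B-Fredholm: `d = dis(T)` is finite, `R(T) + N(T^d)` is closed of finite
codimension and `N(T) ∩ R(T^d)` is topologically complemented. -/
def IsRightBFredholm (T : X →L[ℂ] X) : Prop :=
  ∃ d : ℕ, dis T = d ∧
    IsClosed ((T.range ⊔ (T ^ d).ker : Submodule ℂ X) : Set X) ∧
    FiniteDimensional ℂ (X ⧸ (T.range ⊔ (T ^ d).ker)) ∧
    (T.ker ⊓ (T ^ d).range).ClosedComplemented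

theorem mapsTo_range_pow (T : X →L[ℂ] X) (n : ℕ) :
    Set.MapsTo T (T ^ n).range (T ^ n).range := by
  rintro _ ⟨x, rfl⟩
  refine ⟨T x, ?_⟩
  change (T ^ n * T) x = (T * T ^ n) x
  rw [← pow_succ, ← pow_succ']

/-- The operator `T` restricts to on the range of `Tⁿ`. -/
def restrictRangePow (T : X →L[ℂ] X) (n : ℕ) : (T ^ n).range →L[ℂ] (T ^ n).range :=
  T.restrict (mapsTo_range_pow T n)

/-- `T` is B-Fredholm: for some `n`, `R(Tⁿ)` is closed and the restriction of `T` to `R(Tⁿ)` is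
a Fredholm operator. -/
def IsBFredholm (T : X →L[ℂ] X) : Prop :=
  ∃ n : ℕ, IsClosed ((T ^ n).range : Set X) ∧ (restrictRangePow T n).IsFredholm

/-- The left B-Fredholm spectrum. -/
def leftBFredholmSpectrum (T : X →L[ℂ] X) : Set ℂ :=
  {z | ¬ IsLeftBFredholm (algebraMap ℂ (X →L[ℂ] X) z - T)}

/-- The right B-Fredholm spectrum. -/
def rightBFredholmSpectrum (T : X →L[ℂ] X) : Set ℂ :=
  {z | ¬ IsRightBFredholm (algebraMap ℂ (X →L[ℂ] X) z - T)}

/-- The B-Fredholm spectrum. -/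
def bFredholmSpectrum (T : X →L[ℂ] X) : Set ℂ :=
  {z | ¬ IsBFredholm (algebraMap ℂ (X →L[ℂ] X) z - T)}

end BFredholm

namespace BFredholm

open LinearMap LinearMap.FiniteRangeSetoid

variable {X Y : Type*} [NormedAddCommGroup X] [NormedSpace ℂ X]
  [NormedAddCommGroup Y] [NormedSpace ℂ Y]

/-! For `z ≠ 0`, put `A = z - TS`, `B = z - ST`. Then `SA = BS`, `TB = AT` and `z x = TSx + Ax`.
Hence `R(Aⁿ)` and `R(A) + N(Aⁿ)` are the preimages under `S` of their counterparts for `B`, while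
`z⁻¹T` inverts `S` on `N(A)`. Stable degree, dimensions, closedness and projections thus pass from
`B` to `A`, and back by symmetry. The B-Fredholm case applies Jacobson's inverse formula modulo
finite rank on `R(Aⁿ)` and `R(Bⁿ)`. -/

/-- `A = z - T S` and `B = z - S T` for a nonzero scalar `z`. -/
structure IsJacobsonPair (z : ℂ) (T : Y →L[ℂ] X) (S : X →L[ℂ] Y)
    (A : X →L[ℂ] X) (B : Y →L[ℂ] Y) : Prop where
  ne_zero : z ≠ 0
  comp_apply_left : ∀ x, T (S x) = z • x - A x
  comp_apply_right : ∀ y, S (T y) = z • y - B y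

namespace IsJacobsonPair

variable {z : ℂ} {T : Y →L[ℂ] X} {S : X →L[ℂ] Y} {A : X →L[ℂ] X} {B : Y →L[ℂ] Y}

theorem symm (h : IsJacobsonPair z T S A B) : IsJacobsonPair z S T B A :=
  ⟨h.ne_zero, h.comp_apply_right, h.comp_apply_left⟩

theorem smul_eq (h : IsJacobsonPair z T S A B) (x : X) : z • x = T (S x) + A x := by
  rw [h.comp_apply_left, sub_add_cancel]

theorem mem_of_apply_mem (h : IsJacobsonPair z T S A B) {p : Submodule ℂ X} {x : X}
    (h₁ : T (S x) ∈ p) (h₂ : A x ∈ p) : x ∈ p := by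
  rw [← p.smul_mem_iff h.ne_zero, h.smul_eq]
  exact p.add_mem h₁ h₂

theorem inv_smul_comp_apply_of_mem_ker (h : IsJacobsonPair z T S A B) {x : X} (hx : A x = 0) :
    z⁻¹ • T (S x) = x := by
  rw [h.comp_apply_left, hx, sub_zero, inv_smul_smul₀ h.ne_zero]

theorem intertwine (h : IsJacobsonPair z T S A B) (x : X) : S (A x) = B (S x) := by
  have h₁ := h.comp_apply_right (S x)
  rw [h.comp_apply_left, map_sub, map_smul] at h₁
  exact sub_right_injective h₁

theorem intertwine_pow (h : IsJacobsonPair z T S A B) (n : ℕ) (x : X) :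
    S ((A ^ n) x) = (B ^ n) (S x) := by
  induction n with
  | zero => rfl
  | succ n ih =>
    rw [pow_succ', pow_succ']
    exact (h.intertwine _).trans (congrArg B ih)

theorem apply_mem_ker_pow (h : IsJacobsonPair z T S A B) {n : ℕ} {x : X}
    (hx : x ∈ (A ^ n).ker) : S x ∈ (B ^ n).ker := by
  change (B ^ n) (S x) = 0
  rw [← h.intertwine_pow, show (A ^ n) x = 0 from hx, map_zero]

theorem apply_mem_range_pow (h : IsJacobsonPair z T S A B) {n : ℕ} {x : X}
    (hx : x ∈ (A ^ n).range) : S x ∈ (B ^ n).range := by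
  obtain ⟨y, rfl⟩ := hx
  exact ⟨S y, (h.intertwine_pow n y).symm⟩

theorem mem_range_pow_iff (h : IsJacobsonPair z T S A B) {n : ℕ} {x : X} :
    x ∈ (A ^ n).range ↔ S x ∈ (B ^ n).range := by
  refine ⟨h.apply_mem_range_pow, fun hx => ?_⟩
  induction n with
  | zero => exact ⟨x, rfl⟩
  | succ n ih =>
    -- As `z x = TSx + Ax`, it remains to treat `Ax`: by induction `x ∈ R(Aⁿ)`, so `Ax ∈ R(Aⁿ⁺¹)`.
    refine h.mem_of_apply_mem (h.symm.apply_mem_range_pow hx) ?_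
    obtain ⟨w, hw⟩ := hx
    obtain ⟨y, rfl⟩ := ih ⟨B w, by rw [← hw, pow_succ]; rfl⟩
    exact ⟨y, by rw [pow_succ']; rfl⟩

theorem range_pow_eq_comap (h : IsJacobsonPair z T S A B) (n : ℕ) :
    (A ^ n).range = (B ^ n).range.comap (S : X →ₗ[ℂ] Y) :=
  Submodule.ext fun _ => h.mem_range_pow_iff

theorem apply_mem_ker_inf_range (h : IsJacobsonPair z T S A B) {n : ℕ} {x : X}
    (hx : x ∈ A.ker ⊓ (A ^ n).range) : S x ∈ B.ker ⊓ (B ^ n).range := by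
  refine ⟨?_, h.apply_mem_range_pow hx.2⟩
  change B (S x) = 0
  rw [← h.intertwine, show A x = 0 from hx.1, map_zero]

theorem apply_mem_range_sup_ker (h : IsJacobsonPair z T S A B) {n : ℕ} {x : X}
    (hx : x ∈ A.range ⊔ (A ^ n).ker) : S x ∈ B.range ⊔ (B ^ n).ker := by
  obtain ⟨_, ⟨y, rfl⟩, w, hw, rfl⟩ := Submodule.mem_sup.1 hx
  rw [map_add]
  exact Submodule.add_mem_sup ⟨S y, (h.intertwine y).symm⟩ (h.apply_mem_ker_pow hw)

theorem apply_mem_range_sup (A : X →L[ℂ] X) (p : Submodule ℂ X) (x : X) : A x ∈ A.range ⊔ p :=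
  Submodule.mem_sup_left ⟨x, rfl⟩

/-- In `z x = TSx + Ax` the term `Ax` always lies in `R(A)`, so only `TSx` matters. -/
theorem range_sup_ker_eq_comap (h : IsJacobsonPair z T S A B) (n : ℕ) :
    A.range ⊔ (A ^ n).ker = (B.range ⊔ (B ^ n).ker).comap (S : X →ₗ[ℂ] Y) :=
  le_antisymm (fun _ hx => h.apply_mem_range_sup_ker hx) fun _ hx =>
    h.mem_of_apply_mem (h.symm.apply_mem_range_sup_ker hx) (apply_mem_range_sup _ _ _)

theorem stableSet_subset (h : IsJacobsonPair z T S A B) : stableSet B ⊆ stableSet A := by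
  intro n hn m hnm
  ext x
  simp only [Submodule.mem_inf]
  refine and_congr_right fun hx => ?_
  have hSx : S x ∈ B.ker := by
    change B (S x) = 0
    rw [← h.intertwine, show A x = 0 from hx, map_zero]
  have h₁ := SetLike.ext_iff.1 (hn m hnm) (S x)
  simp only [Submodule.mem_inf, hSx, true_and] at h₁
  rw [h.mem_range_pow_iff, h₁, ← h.mem_range_pow_iff]

theorem dis_eq (h : IsJacobsonPair z T S A B) : dis A = dis B := by
  rw [dis, dis, h.symm.stableSet_subset.antisymm h.stableSet_subset]

theorem finiteDimensional_ker_inf_range (h : IsJacobsonPair z T S A B) (n : ℕ)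
    [FiniteDimensional ℂ ↥(B.ker ⊓ (B ^ n).range)] :
    FiniteDimensional ℂ ↥(A.ker ⊓ (A ^ n).range) := by
  refine FiniteDimensional.of_injective ((S : X →ₗ[ℂ] Y).restrict
    (p := A.ker ⊓ (A ^ n).range) (q := B.ker ⊓ (B ^ n).range)
    fun x hx => h.apply_mem_ker_inf_range hx) ?_
  rintro ⟨x, hx⟩ ⟨y, hy⟩ hxy
  have hS : S x = S y := congrArg Subtype.val hxy
  ext
  change x = y
  rw [← h.inv_smul_comp_apply_of_mem_ker hx.1, ← h.inv_smul_comp_apply_of_mem_ker hy.1, hS]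

theorem finiteDimensional_quotient_range_sup_ker (h : IsJacobsonPair z T S A B) (n : ℕ)
    [FiniteDimensional ℂ (Y ⧸ (B.range ⊔ (B ^ n).ker))] :
    FiniteDimensional ℂ (X ⧸ (A.range ⊔ (A ^ n).ker)) := by
  refine FiniteDimensional.of_injective (Submodule.mapQ (A.range ⊔ (A ^ n).ker)
    (B.range ⊔ (B ^ n).ker) (S : X →ₗ[ℂ] Y) (h.range_sup_ker_eq_comap n).le) ?_
  rw [← LinearMap.ker_eq_bot, Submodule.ker_mapQ, ← h.range_sup_ker_eq_comap,
    Submodule.mkQ_map_self]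

theorem isClosed_range_sup_ker (h : IsJacobsonPair z T S A B) {n : ℕ}
    (hB : IsClosed ((B.range ⊔ (B ^ n).ker : Submodule ℂ Y) : Set Y)) :
    IsClosed ((A.range ⊔ (A ^ n).ker : Submodule ℂ X) : Set X) := by
  rw [h.range_sup_ker_eq_comap]
  exact hB.preimage S.continuous

theorem isClosed_range_pow (h : IsJacobsonPair z T S A B) {n : ℕ}
    (hB : IsClosed ((B ^ n).range : Set Y)) : IsClosed ((A ^ n).range : Set X) := by
  rw [h.range_pow_eq_comap]
  exact hB.preimage S.continuous

/-- A projection `Q` for `B` gives `z⁻¹ T Q S` for `A`, since `z⁻¹TS` is the identity on `N(A)`. -/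
theorem closedComplemented_ker_inf_range (h : IsJacobsonPair z T S A B) {n : ℕ}
    (hB : (B.ker ⊓ (B ^ n).range).ClosedComplemented) :
    (A.ker ⊓ (A ^ n).range).ClosedComplemented := by
  obtain ⟨Q, hQ⟩ := hB
  refine ⟨(z⁻¹ • (T ∘L (Submodule.subtypeL _) ∘L Q ∘L S)).codRestrict _ fun x =>
    Submodule.smul_mem _ _ (h.symm.apply_mem_ker_inf_range (Q (S x)).2), fun x => ?_⟩
  ext
  change z⁻¹ • T (Q (S x)) = (x : X)
  rw [hQ ⟨S x, h.apply_mem_ker_inf_range x.2⟩]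
  exact h.inv_smul_comp_apply_of_mem_ker x.2.1

/-- If `Q` is a projection onto `R(B) + N(Bⁿ)`, then `z⁻¹ (A + T Q S)` is one onto
`R(A) + N(Aⁿ)`. -/
theorem closedComplemented_range_sup_ker (h : IsJacobsonPair z T S A B) {n : ℕ}
    (hB : (B.range ⊔ (B ^ n).ker).ClosedComplemented) :
    (A.range ⊔ (A ^ n).ker).ClosedComplemented := by
  obtain ⟨Q, hQ⟩ := hB
  refine ⟨(z⁻¹ • (A + T ∘L (Submodule.subtypeL _) ∘L Q ∘L S)).codRestrict _ fun x =>
    Submodule.smul_mem _ _ (Submodule.add_mem _ (apply_mem_range_sup _ _ _)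
      (h.symm.apply_mem_range_sup_ker (Q (S x)).2)), fun x => ?_⟩
  ext
  change z⁻¹ • (A x + T (Q (S x))) = (x : X)
  rw [hQ ⟨S x, h.apply_mem_range_sup_ker x.2⟩]
  change z⁻¹ • (A x + T (S x)) = (x : X)
  rw [add_comm, ← h.smul_eq, inv_smul_smul₀ h.ne_zero]

theorem isLeftBFredholm (h : IsJacobsonPair z T S A B) (hB : IsLeftBFredholm B) :
    IsLeftBFredholm A := by
  obtain ⟨d, hd, _, hc⟩ := hB
  exact ⟨d, h.dis_eq.trans hd, h.finiteDimensional_ker_inf_range d,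
    h.closedComplemented_range_sup_ker hc⟩

theorem isRightBFredholm (h : IsJacobsonPair z T S A B) (hB : IsRightBFredholm B) :
    IsRightBFredholm A := by
  obtain ⟨d, hd, hcl, _, hc⟩ := hB
  exact ⟨d, h.dis_eq.trans hd, h.isClosed_range_sup_ker hcl,
    h.finiteDimensional_quotient_range_sup_ker d, h.closedComplemented_ker_inf_range hc⟩

/-- If `V` is a quasi-inverse of `z - S T`, then `z⁻¹ (1 + T V S)` is one of `z - T S`. -/
theorem isFredholm (h : IsJacobsonPair z T S A B) (hB : B.IsFredholm) : A.IsFredholm := by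
  obtain ⟨V, hVB, hBV⟩ := hB.exists_isQuasiInverse
  refine .of_isQuasiInverse
    (v := z⁻¹ • (ContinuousLinearMap.id ℂ X + T ∘L V ∘L S)) ⟨?_, ?_⟩
  · rw [IsLeftQuasiInverse, equiv_iff_hasFiniteRange] at hVB ⊢
    -- The error for `A` is exactly `z⁻¹ T (VB - 1) S`, of finite rank.
    have := ((hVB.comp_right (S : X →ₗ[ℂ] Y)).comp_left (T : Y →ₗ[ℂ] X)).smul z⁻¹
    convert this using 1
    ext x
    change z⁻¹ • (A x + T (V (S (A x)))) - x = z⁻¹ • T (V (B (S x)) - S x)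
    have hx : x = z⁻¹ • (T (S x) + A x) := by rw [← h.smul_eq, inv_smul_smul₀ h.ne_zero]
    nth_rw 3 [hx]
    rw [h.intertwine, map_sub]
    module
  · rw [IsRightQuasiInverse, equiv_iff_hasFiniteRange] at hBV ⊢
    have := ((hBV.comp_right (S : X →ₗ[ℂ] Y)).comp_left (T : Y →ₗ[ℂ] X)).smul z⁻¹
    convert this using 1
    ext x
    change A (z⁻¹ • (x + T (V (S x)))) - x = z⁻¹ • T (B (V (S x)) - S x)
    have hx : x = z⁻¹ • (T (S x) + A x) := by rw [← h.smul_eq, inv_smul_smul₀ h.ne_zero]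
    nth_rw 3 [hx]
    rw [map_smul, map_add, map_sub, h.symm.intertwine]
    module

/-- The two ranges are different spaces, hence the separate `X` and `Y` in `IsJacobsonPair`. -/
theorem restrict_range_pow (h : IsJacobsonPair z T S A B) (n : ℕ) :
    IsJacobsonPair z
      (T.restrict (p := (B ^ n).range) (q := (A ^ n).range)
        fun _ hx => h.symm.apply_mem_range_pow hx)
      (S.restrict (p := (A ^ n).range) (q := (B ^ n).range)
        fun _ hx => h.apply_mem_range_pow hx)
      (restrictRangePow A n) (restrictRangePow B n) where
  ne_zero := h.ne_zero
  comp_apply_left x := Subtype.ext (h.comp_apply_left x)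
  comp_apply_right y := Subtype.ext (h.comp_apply_right y)

theorem isBFredholm (h : IsJacobsonPair z T S A B) (hB : IsBFredholm B) : IsBFredholm A := by
  obtain ⟨n, hcl, hn⟩ := hB
  exact ⟨n, h.isClosed_range_pow hcl, (h.restrict_range_pow n).isFredholm hn⟩

end IsJacobsonPair

theorem isJacobsonPair_sub_mul {z : ℂ} (hz : z ≠ 0) (T S : X →L[ℂ] X) :
    IsJacobsonPair z T S (algebraMap ℂ (X →L[ℂ] X) z - T * S)
      (algebraMap ℂ (X →L[ℂ] X) z - S * T) where
  ne_zero := hz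
  comp_apply_left x := (sub_sub_cancel (z • x) (T (S x))).symm
  comp_apply_right x := (sub_sub_cancel (z • x) (S (T x))).symm

end BFredholm

theorem mainTheorem8 {X : Type*} [NormedAddCommGroup X] [NormedSpace ℂ X] [CompleteSpace X]
    (T S : X →L[ℂ] X) :
    BFredholm.leftBFredholmSpectrum (T * S) \ {0} =
        BFredholm.leftBFredholmSpectrum (S * T) \ {0} ∧
      BFredholm.rightBFredholmSpectrum (T * S) \ {0} =
        BFredholm.rightBFredholmSpectrum (S * T) \ {0} ∧
      BFredholm.bFredholmSpectrum (T * S) \ {0} =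
        BFredholm.bFredholmSpectrum (S * T) \ {0} := by
  have key : ∀ P : (X →L[ℂ] X) → Prop,
      (∀ z A B (T S : X →L[ℂ] X), BFredholm.IsJacobsonPair z T S A B → P B → P A) →
      {z | ¬ P (algebraMap ℂ (X →L[ℂ] X) z - T * S)} \ {0} =
        {z | ¬ P (algebraMap ℂ (X →L[ℂ] X) z - S * T)} \ {0} := by
    intro P hP
    ext z
    refine and_congr_left fun hz => not_congr ?_
    have h := BFredholm.isJacobsonPair_sub_mul (z := z) hz T S
    exact ⟨hP _ _ _ _ _ h.symm, hP _ _ _ _ _ h⟩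
  exact ⟨key _ fun _ _ _ _ _ h => h.isLeftBFredholm,
    key _ fun _ _ _ _ _ h => h.isRightBFredholm, key _ fun _ _ _ _ _ h => h.isBFredholm⟩
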